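/- For integers $n,k\ge 0$ and a real number $p$, let $\mathcal A(n,k,p)$ be the set of all probability distributions $\mathbb Q$ of $n$ bits $(X_1,\dots,X_n)\in\{0,1\}^n$ such that $\mathbb Q(X_i=1)=p$ for all $i$ and any at most $k$ of the bits $X_1,\dots,X_n$ are independent under $\mathbb Q$. Let $$m(n,k,p):=\min_{\mathbb Q\in\mathcal A(n,k,p)}\mathbb Q(X_1=\dots=X_n=1),\qquad n_c(k,p):=\min\{n\ge 0 : m(n,k,p)=0\}.$$ **Theorem.** (a) For every integer $k\ge 0$ and every real $p$ with $\tfrac12\le p<1$, the number $n_c(k,p)$ exists (that is, $m(n,k,p)=0$ for some $n$), and $$n_c(k,p)\ \ge\ \begin{cases}\dfrac{k}{2(1-p)}+1 & \text{if } k \text{ is even},\\[2ex] \dfrac{k+1}{2(1-p)} & \text{if } k\text{ is odd}.\end{cases}$$ (b) There is an absolute constant $C>0$ such that for every integer $k\ge 1$, every prime power $q$ and $p=1-\tfrac1q$, $$n_c(k,p)\ \le\ C\,\frac{k}{1-p}\,\log\Bigl(\frac1{1-p}\Bigr).$$ -/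

import Mathlib

open MeasureTheory ProbabilityTheory

/-- The set of all `k`-wise independent distributions on `n` bits `(X_1, …, X_n)` (with
`X_i ω = ω i`, and `true` standing for the bit `1`) such that every bit equals `1` with
probability `p`: any at most `k` of the bits are independent. -/
def kWiseIndep (n k : ℕ) (p : ℝ) : Set (Measure (Fin n → Bool)) :=
  {Q | IsProbabilityMeasure Q ∧
    (∀ i : Fin n, Q.real {ω | ω i = true} = p) ∧
    ∀ s : Finset (Fin n), s.card ≤ k → iIndepFun (fun (i : s) (ω : Fin n → Bool) => ω i) Q}

/-- All values that the probability of the all-ones vector takes on the `k`-wise independent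
distributions on `n` bits with marginal `p`. -/
def allOnesProbs (n k : ℕ) (p : ℝ) : Set ℝ :=
  (fun Q : Measure (Fin n → Bool) => Q.real {ω | ∀ i, ω i = true}) '' kWiseIndep n k p

/-- The lengths `n` for which the minimal probability of the all-ones vector, over all `k`-wise
independent distributions on `n` bits with marginal `p`, is `0`. -/
def zeroLengths (k : ℕ) (p : ℝ) : Set ℕ :=
  {n | IsLeast (allOnesProbs n k p) 0}

/-- The critical length: the least `n` for which the minimal probability of the all-ones vector
is `0` (it is a minimum whenever `zeroLengths k p` is nonempty). -/
noncomputable def criticalLength (k : ℕ) (p : ℝ) : ℕ :=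
  sInf (zeroLengths k p)

/-!
Write `Y i` for the indicator that the `i`-th bit is `0`, `r = 1 - p` for its mean and `N` for the
number of zero bits. A length `n` lies in `zeroLengths k p` exactly when there is a `k`-wise
independent law for the `Y i` under which `N ≥ 1` almost surely. Everything about such a law that
matters is contained in the moments of products of at most `k` bits (`HasProductMoments`), so the
argument takes place on finite weighted spaces; the translation to measures is
`hasProductMoments_of_mem_kWiseIndep` and `mem_zeroLengths_of_hasProductMoments`.

*Lower bound.* Let `k = 2m + 1`. The elementary symmetric function of degree `m + 1` in the centred
bits `Y i - r` is a polynomial `K` in `N`, the Krawtchouk polynomial, and it is orthogonal to all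
polynomials in `N` of degree at most `m`; this orthogonality only involves moments of order at most
`k`. If `n r < m + 1`, then `K` changes sign between `0` and `1`, hence has a root `ξ < 1`, and
`K = (X - ξ) g` with `deg g ≤ m`. The mean of `K(N) g(N) = (N - ξ) g(N) ^ 2` is zero while `N > ξ`
almost surely, so `g(N) = 0` almost surely. This is impossible for a nonzero polynomial of that
degree (`HasProductMoments.exists_eval_ne_zero`), which proves `HasProductMoments.le_card_mul`.
Even `k ≥ 2` reduces to `k - 1`, with `n - 1` bits, by conditioning on one bit being `1`.

*Upper bound.* For a prime power `q` and `p = 1 - 1 / q`, let the `i`-th bit indicate that the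
`i`-th coordinate of a uniformly random word of a linear code over the field with `q` elements is
nonzero. The bits are `k`-wise independent if any `k` rows of the generating matrix are linearly
independent, and the all-ones vector is impossible if every word has a zero coordinate. A uniformly
random `n × d` matrix has both properties with positive probability for `d = 11 k` and `n` of order
`k q log q`, by a union bound over words and over dependency vectors of weight at most `k`
(`exists_rows_of_count_lt_one`, `exists_mem_zeroLengths_card`).

*Existence.* For an arbitrary `p < 1`, take a power `q` of two with `p ≤ 1 - 1 / q` and multiply the
bits of the construction for `q` by independent Bernoulli bits (`mem_zeroLengths_of_le`).
-/

/-! ### Product moments on a finite weighted space -/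

/-- The functions `x i` on the finite space `Ω` with weights `W` have the moments of `k`-wise
independent bits: the sum of every product of at most `k` distinct ones is what it would be for
independent bits with mean `p`, on a space of total mass `c`. Allowing `c ≠ 1` covers
unnormalised conditional distributions. -/
def HasProductMoments {Ω ι : Type*} [Fintype Ω] (W : Ω → ℝ) (x : ι → Ω → ℝ) (k : ℕ) (c p : ℝ) :
    Prop :=
  ∀ T : Finset ι, T.card ≤ k → ∑ a, W a * ∏ i ∈ T, x i a = c * p ^ T.card

section Moments

variable {Ω ι : Type*} [Fintype Ω] {W : Ω → ℝ} {x y : ι → Ω → ℝ} {k : ℕ} {c p r : ℝ}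

lemma HasProductMoments.sum_prod_affine (h : HasProductMoments W x k c p) {U : Finset ι}
    (hU : U.card ≤ k) (α β : ι → ℝ) :
    ∑ a, W a * ∏ i ∈ U, (α i + β i * x i a) = c * ∏ i ∈ U, (α i + β i * p) := by
  classical
  have expand : ∀ z : ι → ℝ, ∏ i ∈ U, (α i + β i * z i) =
      ∑ t ∈ U.powerset, ((∏ i ∈ U \ t, α i) * ∏ i ∈ t, β i) * ∏ i ∈ t, z i := by
    intro z
    have := Finset.prod_add (fun i => β i * z i) α U
    simp only [add_comm (α _)]
    rw [this]
    refine Finset.sum_congr rfl fun t _ => ?_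
    rw [Finset.prod_mul_distrib]
    ring
  have h1 : ∀ a, W a * ∏ i ∈ U, (α i + β i * x i a) =
      ∑ t ∈ U.powerset, ((∏ i ∈ U \ t, α i) * ∏ i ∈ t, β i) * (W a * ∏ i ∈ t, x i a) := by
    intro a
    rw [expand (fun i => x i a), Finset.mul_sum]
    exact Finset.sum_congr rfl fun t _ => by ring
  simp only [h1]
  rw [Finset.sum_comm, expand (fun _ => p), Finset.mul_sum]
  refine Finset.sum_congr rfl fun t ht => ?_
  rw [← Finset.mul_sum, h t ((Finset.card_le_card (Finset.mem_powerset.1 ht)).trans hU),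
    Finset.prod_const]
  ring

lemma HasProductMoments.one_sub (h : HasProductMoments W x k c p) :
    HasProductMoments W (fun i a => 1 - x i a) k c (1 - p) := by
  intro T hT
  have := h.sum_prod_affine hT (fun _ => 1) (fun _ => -1)
  simpa [neg_mul, ← sub_eq_add_neg] using this

/-- Products of centred bits `y i - r` and of bits `y i` still factor, because on `{0, 1}` each
factor is an affine function of a single bit. -/
lemma HasProductMoments.sum_centered_mul [DecidableEq ι] (h : HasProductMoments W y k c r)
    (hy : ∀ i a, y i a = 0 ∨ y i a = 1) {S T : Finset ι} (hST : S.card + T.card ≤ k) :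
    ∑ a, W a * ((∏ i ∈ S, (y i a - r)) * ∏ i ∈ T, y i a) =
      c * ∏ i ∈ S ∪ T, (if i ∈ S then (if i ∈ T then r * (1 - r) else 0) else r) := by
  have := h.sum_prod_affine ((Finset.card_union_le S T).trans hST)
    (fun i => if i ∈ S then (if i ∈ T then 0 else -r) else 0)
    (fun i => if i ∈ S then (if i ∈ T then 1 - r else 1) else 1)
  convert this using 1
  · refine Finset.sum_congr rfl fun a _ => ?_
    congr 1
    have e1 : ∏ i ∈ S, (y i a - r) = ∏ i ∈ S ∪ T, if i ∈ S then y i a - r else 1 := by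
      rw [Finset.prod_ite_mem, Finset.union_inter_cancel_left]
    have e2 : ∏ i ∈ T, y i a = ∏ i ∈ S ∪ T, if i ∈ T then y i a else 1 := by
      rw [Finset.prod_ite_mem, Finset.union_inter_cancel_right]
    rw [e1, e2, ← Finset.prod_mul_distrib]
    refine Finset.prod_congr rfl fun i hi => ?_
    have := Finset.mem_union.1 hi
    rcases hy i a with h0 | h0 <;> by_cases h1 : i ∈ S <;> by_cases h2 : i ∈ T <;>
      simp_all [sub_eq_neg_add]
  · congr 1
    refine Finset.prod_congr rfl fun i hi => ?_
    have := Finset.mem_union.1 hi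
    by_cases h1 : i ∈ S <;> by_cases h2 : i ∈ T <;> simp_all
    ring

lemma HasProductMoments.sum_centered_mul_eq_zero [DecidableEq ι]
    (h : HasProductMoments W y k c r)
    (hy : ∀ i a, y i a = 0 ∨ y i a = 1) {S T : Finset ι} (hST : S.card + T.card ≤ k)
    (hsub : ¬ S ⊆ T) :
    ∑ a, W a * ((∏ i ∈ S, (y i a - r)) * ∏ i ∈ T, y i a) = 0 := by
  obtain ⟨i, hiS, hiT⟩ := Finset.not_subset.1 hsub
  rw [h.sum_centered_mul hy hST, Finset.prod_eq_zero (i := i), mul_zero]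
  · exact Finset.mem_union_left _ hiS
  · simp [hiS, hiT]

lemma HasProductMoments.sum_centered_mul_self [DecidableEq ι]
    (h : HasProductMoments W y k c r)
    (hy : ∀ i a, y i a = 0 ∨ y i a = 1) {S : Finset ι} (hS : S.card + S.card ≤ k) :
    ∑ a, W a * ((∏ i ∈ S, (y i a - r)) * ∏ i ∈ S, y i a) = c * (r * (1 - r)) ^ S.card := by
  rw [h.sum_centered_mul hy hS, Finset.union_self, ← Finset.prod_const]
  congr 1
  exact Finset.prod_congr rfl fun i hi => by simp [hi]

lemma sum_pow_eq_sum_prod_image [Fintype ι] [DecidableEq ι] {z : ι → ℝ}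
    (hz : ∀ i, z i = 0 ∨ z i = 1) (j : ℕ) :
    (∑ i, z i) ^ j = ∑ f : Fin j → ι, ∏ i ∈ Finset.univ.image f, z i := by
  rw [Fintype.sum_pow]
  refine Finset.sum_congr rfl fun f _ => ?_
  by_cases hf : ∀ t, z (f t) = 1
  · rw [Finset.prod_eq_one fun t _ => hf t, Finset.prod_eq_one]
    intro i hi
    obtain ⟨t, -, rfl⟩ := Finset.mem_image.1 hi
    exact hf t
  · push Not at hf
    obtain ⟨t, ht⟩ := hf
    have h0 : z (f t) = 0 := (hz _).resolve_right ht
    rw [Finset.prod_eq_zero (Finset.mem_univ t) h0,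
      Finset.prod_eq_zero (Finset.mem_image_of_mem f (Finset.mem_univ t)) h0]

lemma sum_weight_mul_pow [Fintype ι] [DecidableEq ι]
    (hy : ∀ i a, y i a = 0 ∨ y i a = 1) (S : Finset ι) (j : ℕ) :
    ∑ a, W a * ((∏ i ∈ S, (y i a - r)) * (∑ i, y i a) ^ j) =
      ∑ f : Fin j → ι, ∑ a, W a * ((∏ i ∈ S, (y i a - r)) *
        ∏ i ∈ Finset.univ.image f, y i a) := by
  rw [Finset.sum_comm]
  refine Finset.sum_congr rfl fun a _ => ?_
  rw [sum_pow_eq_sum_prod_image (fun i => hy i a), Finset.mul_sum, Finset.mul_sum]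

lemma card_image_fin_le [DecidableEq ι] {j : ℕ} (f : Fin j → ι) :
    (Finset.univ.image f).card ≤ j :=
  Finset.card_image_le.trans (by simp)

lemma HasProductMoments.sum_centered_mul_pow_eq_zero [Fintype ι]
    (h : HasProductMoments W y k c r) (hy : ∀ i a, y i a = 0 ∨ y i a = 1) {S : Finset ι} {j : ℕ}
    (hj : j < S.card) (hS : S.card + j ≤ k) :
    ∑ a, W a * ((∏ i ∈ S, (y i a - r)) * (∑ i, y i a) ^ j) = 0 := by
  classical
  rw [sum_weight_mul_pow hy]
  refine Finset.sum_eq_zero fun f _ => ?_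
  have hf := card_image_fin_le f
  exact h.sum_centered_mul_eq_zero hy (by omega)
    fun hsub => by have := Finset.card_le_card hsub; omega

lemma HasProductMoments.sum_centered_mul_pow_pos [Fintype ι]
    (h : HasProductMoments W y k c r) (hy : ∀ i a, y i a = 0 ∨ y i a = 1)
    (hc : 0 < c) (hr0 : 0 < r) (hr1 : r < 1) {S : Finset ι} (hS : S.card + S.card ≤ k) :
    0 < ∑ a, W a * ((∏ i ∈ S, (y i a - r)) * (∑ i, y i a) ^ S.card) := by
  classical
  have hv : 0 < c * (r * (1 - r)) ^ S.card :=
    mul_pos hc (pow_pos (mul_pos hr0 (sub_pos.2 hr1)) _)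
  rw [sum_weight_mul_pow hy]
  refine Finset.sum_pos' (fun f _ => ?_)
    ⟨fun t => (S.equivFin.symm t : ι), Finset.mem_univ _, ?_⟩
  · have hf := card_image_fin_le f
    by_cases hsub : S ⊆ Finset.univ.image f
    · rw [← Finset.eq_of_subset_of_card_le hsub hf, h.sum_centered_mul_self hy hS]
      exact hv.le
    · rw [h.sum_centered_mul_eq_zero hy (by omega) hsub]
  · have : Finset.univ.image (fun t => (S.equivFin.symm t : ι)) = S := by
      ext i
      simp only [Finset.mem_image, Finset.mem_univ, true_and]
      exact ⟨by rintro ⟨t, rfl⟩; exact (S.equivFin.symm t).2,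
        fun hi => ⟨S.equivFin ⟨i, hi⟩, by simp⟩⟩
    rw [this, h.sum_centered_mul_self hy hS]
    exact hv

/-- The `m`-th elementary symmetric function of the centred bits is orthogonal to polynomials of
degree less than `m` in the number of ones. -/
lemma HasProductMoments.sum_esymm_mul_eval_eq_zero [Fintype ι]
    (h : HasProductMoments W y k c r) (hy : ∀ i a, y i a = 0 ∨ y i a = 1) {m : ℕ}
    {g : Polynomial ℝ} (hg : g.natDegree < m) (hk : m + g.natDegree ≤ k) :
    ∑ a, W a * ((∑ S ∈ Finset.powersetCard m Finset.univ, ∏ i ∈ S, (y i a - r)) *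
      g.eval (∑ i, y i a)) = 0 := by
  have h1 : ∀ a, W a * ((∑ S ∈ Finset.powersetCard m Finset.univ, ∏ i ∈ S, (y i a - r)) *
      g.eval (∑ i, y i a)) = ∑ S ∈ Finset.powersetCard m Finset.univ,
        ∑ j ∈ Finset.range (g.natDegree + 1), g.coeff j *
          (W a * ((∏ i ∈ S, (y i a - r)) * (∑ i, y i a) ^ j)) := by
    intro a
    rw [Polynomial.eval_eq_sum_range, Finset.sum_mul_sum, Finset.mul_sum]
    refine Finset.sum_congr rfl fun S _ => ?_
    rw [Finset.mul_sum]
    exact Finset.sum_congr rfl fun j _ => by ring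
  simp only [h1]
  rw [Finset.sum_comm]
  refine Finset.sum_eq_zero fun S hS => ?_
  rw [Finset.sum_comm]
  refine Finset.sum_eq_zero fun j hj => ?_
  have hS' := (Finset.mem_powersetCard.1 hS).2
  have hj' := Finset.mem_range.1 hj
  rw [← Finset.mul_sum, h.sum_centered_mul_pow_eq_zero hy (by omega) (by omega), mul_zero]

/-- A nonzero polynomial of degree at most `k / 2` and at most the number of bits, evaluated at the
number of ones, does not vanish on the whole support. -/
lemma HasProductMoments.exists_eval_ne_zero [Fintype ι]
    (h : HasProductMoments W y k c r) (hy : ∀ i a, y i a = 0 ∨ y i a = 1)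
    (hc : 0 < c) (hr0 : 0 < r) (hr1 : r < 1) {g : Polynomial ℝ} (hg : g ≠ 0)
    (hk : g.natDegree + g.natDegree ≤ k) (hcard : g.natDegree ≤ Fintype.card ι) :
    ∃ a, W a ≠ 0 ∧ g.eval (∑ i, y i a) ≠ 0 := by
  by_contra! hcon
  obtain ⟨S, -, hS⟩ := Finset.exists_subset_card_eq (s := (Finset.univ : Finset ι))
    (by simpa using hcard)
  have h0 : ∑ a, W a * ((∏ i ∈ S, (y i a - r)) * g.eval (∑ i, y i a)) = 0 := by
    refine Finset.sum_eq_zero fun a _ => ?_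
    by_cases ha : W a = 0
    · simp [ha]
    · simp [hcon a ha]
  have h1 : ∀ a, W a * ((∏ i ∈ S, (y i a - r)) * g.eval (∑ i, y i a)) =
        ∑ j ∈ Finset.range (g.natDegree + 1), g.coeff j *
          (W a * ((∏ i ∈ S, (y i a - r)) * (∑ i, y i a) ^ j)) := by
    intro a
    rw [Polynomial.eval_eq_sum_range, Finset.mul_sum, Finset.mul_sum]
    exact Finset.sum_congr rfl fun j _ => by ring
  simp only [h1] at h0
  rw [Finset.sum_comm, Finset.sum_range_succ, Finset.sum_eq_zero, zero_add, ← Finset.mul_sum] at h0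
  · have hpos := h.sum_centered_mul_pow_pos hy hc hr0 hr1 (S := S) (by omega)
    rw [hS] at hpos
    rcases mul_eq_zero.1 h0 with h2 | h2
    · exact hg (Polynomial.leadingCoeff_eq_zero.1 h2)
    · exact hpos.ne' h2
  · intro j hj
    have hj' := Finset.mem_range.1 hj
    rw [← Finset.mul_sum, h.sum_centered_mul_pow_eq_zero hy (by omega) (by omega), mul_zero]

end Moments

/-! ### Krawtchouk polynomials and the lower bound -/

lemma card_filter_superset_powersetCard {ι : Type*} [Fintype ι] [DecidableEq ι] {m : ℕ}
    {T : Finset ι} (hT : T.card ≤ m) :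
    ((Finset.powersetCard m Finset.univ).filter (T ⊆ ·)).card =
      (Fintype.card ι - T.card).choose (m - T.card) := by
  rw [← Finset.card_compl, ← Finset.card_powersetCard]
  refine Finset.card_nbij' (· \ T) (· ∪ T) ?_ ?_ ?_ ?_
  · intro S hS
    simp only [Finset.coe_filter, Finset.mem_powersetCard, Set.mem_ofPred_eq] at hS
    simp only [Finset.mem_coe, Finset.mem_powersetCard, Finset.card_sdiff_of_subset hS.2, hS.1.2,
      and_true]
    intro i hi
    simpa using (Finset.mem_sdiff.1 hi).2
  · intro S hS
    simp only [Finset.mem_coe, Finset.mem_powersetCard] at hS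
    have hd : Disjoint S T := Finset.disjoint_left.2 fun i hi => by simpa using hS.1 hi
    simp [Finset.card_union_of_disjoint hd, hS.2, hT]
  · intro S hS
    simp only [Finset.coe_filter, Finset.mem_powersetCard, Set.mem_ofPred_eq] at hS
    exact Finset.sdiff_union_of_subset hS.2
  · intro S hS
    simp only [Finset.mem_coe, Finset.mem_powersetCard] at hS
    have hd : Disjoint S T := Finset.disjoint_left.2 fun i hi => by simpa using hS.1 hi
    exact Finset.union_sdiff_cancel_right hd

open Polynomial in
/-- The Krawtchouk polynomial of degree `m` for the binomial distribution with parameters `n` and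
`r`, normalised so that its value at the number of ones among `n` bits is the `m`-th elementary
symmetric function of the centred bits. -/
noncomputable def krawtchouk (n m : ℕ) (r : ℝ) : Polynomial ℝ :=
  ∑ j ∈ Finset.range (m + 1),
    C ((-r) ^ (m - j) * ((n - j).choose (m - j) : ℝ) / (j.factorial : ℝ)) * descPochhammer ℝ j

lemma natDegree_krawtchouk_le (n m : ℕ) (r : ℝ) : (krawtchouk n m r).natDegree ≤ m := by
  refine Polynomial.natDegree_sum_le_of_forall_le _ _ fun j hj => ?_
  refine (Polynomial.natDegree_C_mul_le _ _).trans ?_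
  rw [descPochhammer_natDegree]
  exact Nat.lt_succ_iff.1 (Finset.mem_range.1 hj)

lemma eval_krawtchouk (n m : ℕ) (r : ℝ) (N : ℕ) :
    (krawtchouk n m r).eval (N : ℝ) = ∑ j ∈ Finset.range (m + 1),
      (-r) ^ (m - j) * ((n - j).choose (m - j) : ℝ) * (N.choose j : ℝ) := by
  rw [krawtchouk, Polynomial.eval_finsetSum]
  refine Finset.sum_congr rfl fun j _ => ?_
  have hj : (j.factorial : ℝ) ≠ 0 := by positivity
  rw [Polynomial.eval_mul, Polynomial.eval_C, descPochhammer_eval_eq_descFactorial,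
    Nat.descFactorial_eq_factorial_mul_choose]
  push_cast
  field_simp

lemma sum_eq_card_filter_eq_one {ι : Type*} [Fintype ι] {z : ι → ℝ}
    (hz : ∀ i, z i = 0 ∨ z i = 1) [DecidablePred fun i => z i = 1] :
    ∑ i, z i = ((Finset.univ.filter fun i => z i = 1).card : ℝ) := by
  rw [Finset.card_filter]
  push_cast
  refine Finset.sum_congr rfl fun i _ => ?_
  rcases hz i with h | h <;> simp [h]

lemma sum_powersetCard_prod_eq_choose {ι : Type*} [Fintype ι] {z : ι → ℝ}
    (hz : ∀ i, z i = 0 ∨ z i = 1) [DecidablePred fun i => z i = 1] (j : ℕ) :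
    ∑ T ∈ Finset.powersetCard j Finset.univ, ∏ i ∈ T, z i =
      ((Finset.univ.filter fun i => z i = 1).card.choose j : ℝ) := by
  classical
  rw [← Finset.card_powersetCard, Finset.card_eq_sum_ones]
  push_cast
  rw [← Finset.sum_subset
    (Finset.powersetCard_mono (Finset.filter_subset (fun i => z i = 1) Finset.univ))]
  · refine Finset.sum_congr rfl fun T hT => Finset.prod_eq_one fun i hi => ?_
    exact (Finset.mem_filter.1 ((Finset.mem_powersetCard.1 hT).1 hi)).2
  · intro T hT hT'
    simp only [Finset.mem_powersetCard, Finset.subset_univ, true_and] at hT hT'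
    obtain ⟨i, hi, hi'⟩ := Finset.not_subset.1 fun hs => hT' ⟨hs, hT⟩
    exact Finset.prod_eq_zero hi ((hz i).resolve_right (by simpa using hi'))

lemma esymm_centered_eq_eval_krawtchouk {ι : Type*} [Fintype ι] {z : ι → ℝ}
    (hz : ∀ i, z i = 0 ∨ z i = 1) (m : ℕ) (r : ℝ) :
    ∑ S ∈ Finset.powersetCard m Finset.univ, ∏ i ∈ S, (z i - r) =
      (krawtchouk (Fintype.card ι) m r).eval (∑ i, z i) := by
  classical
  rw [sum_eq_card_filter_eq_one hz, eval_krawtchouk]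
  simp only [← sum_powersetCard_prod_eq_choose hz]
  have h1 : ∀ S ∈ Finset.powersetCard m (Finset.univ : Finset ι), ∏ i ∈ S, (z i - r) =
      ∑ j ∈ Finset.range (m + 1), ∑ T ∈ Finset.powersetCard j Finset.univ,
        if T ⊆ S then (-r) ^ (m - j) * ∏ i ∈ T, z i else 0 := by
    intro S hS
    have hSm := (Finset.mem_powersetCard.1 hS).2
    simp only [sub_eq_add_neg]
    rw [Finset.prod_add, Finset.sum_powerset, hSm]
    refine Finset.sum_congr rfl fun j _ => ?_
    rw [← Finset.sum_filter]
    refine Finset.sum_congr ?_ fun T hT => ?_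
    · ext T
      simp [Finset.mem_powersetCard, and_comm]
    · simp only [Finset.mem_filter, Finset.mem_powersetCard] at hT
      rw [Finset.prod_const, Finset.card_sdiff_of_subset hT.2, hSm, hT.1.2, mul_comm]
  rw [Finset.sum_congr rfl h1, Finset.sum_comm]
  refine Finset.sum_congr rfl fun j hj => ?_
  rw [Finset.sum_comm, Finset.mul_sum]
  refine Finset.sum_congr rfl fun T hT => ?_
  have hTj := (Finset.mem_powersetCard.1 hT).2
  rw [← Finset.sum_filter, Finset.sum_const,
    card_filter_superset_powersetCard (by have := Finset.mem_range.1 hj; omega), hTj, nsmul_eq_mul]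
  ring

lemma eval_krawtchouk_zero (n m : ℕ) (r : ℝ) :
    (krawtchouk n m r).eval 0 = (-r) ^ m * (n.choose m : ℝ) := by
  have := eval_krawtchouk n m r 0
  rw [Finset.sum_range_succ', Finset.sum_eq_zero] at this
  · simpa using this
  · intro j _
    simp

lemma eval_krawtchouk_one (n m : ℕ) (r : ℝ) :
    (krawtchouk (n + 1) (m + 1) r).eval 1 =
      (-r) ^ m * (n.choose m : ℝ) * (1 - (n + 1) * r / (m + 1)) := by
  have := eval_krawtchouk (n + 1) (m + 1) r 1
  rw [Finset.sum_range_succ', Finset.sum_range_succ', Finset.sum_eq_zero] at this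
  · have hc : ((n : ℝ) + 1) * n.choose m = (n + 1).choose (m + 1) * (m + 1) := by
      exact_mod_cast Nat.add_one_mul_choose_eq n m
    have hm : (m : ℝ) + 1 ≠ 0 := by positivity
    simp only [Nat.cast_one, zero_add, Nat.add_sub_cancel, Nat.choose_self, mul_one,
      Nat.sub_zero, Nat.choose_zero_right] at this
    rw [this]
    have hc' : ((n + 1).choose (m + 1) : ℝ) = ((n : ℝ) + 1) * n.choose m / (m + 1) := by
      rw [hc]; field_simp
    rw [hc']
    field_simp
    ring
  · intro j _
    simp [Nat.choose_eq_zero_of_lt]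

/-- The Krawtchouk polynomial has a root in `(0, 1)` when its degree exceeds the mean of the
binomial distribution. -/
lemma exists_root_krawtchouk {n m : ℕ} {r : ℝ} (hr : 0 < r) (hmn : m ≤ n)
    (hlt : ((n : ℝ) + 1) * r < m + 1) :
    ∃ ξ, 0 < ξ ∧ ξ < 1 ∧ (krawtchouk (n + 1) (m + 1) r).IsRoot ξ := by
  set K := krawtchouk (n + 1) (m + 1) r
  have h0 := eval_krawtchouk_zero (n + 1) (m + 1) r
  have h1 := eval_krawtchouk_one n m r
  have hc0 : (0 : ℝ) < (n + 1).choose (m + 1) := by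
    exact_mod_cast Nat.choose_pos (by omega)
  have hc1 : (0 : ℝ) < n.choose m := by exact_mod_cast Nat.choose_pos hmn
  have hpos : 0 < 1 - ((n : ℝ) + 1) * r / (m + 1) := by
    rw [sub_pos, div_lt_one (by positivity)]
    exact hlt
  have hcont : ContinuousOn (fun t => K.eval t) (Set.Icc 0 1) := K.continuous.continuousOn
  rcases Nat.even_or_odd m with he | ho
  · have hA : K.eval 0 < 0 := by
      rw [h0, (he.add_one).neg_pow]
      have := mul_pos (pow_pos hr (m + 1)) hc0
      linarith
    have hB : 0 < K.eval 1 := by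
      rw [h1, he.neg_pow]; positivity
    obtain ⟨ξ, hξ, hK⟩ := intermediate_value_Ioo zero_le_one hcont ⟨hA, hB⟩
    exact ⟨ξ, hξ.1, hξ.2, hK⟩
  · have hA : 0 < K.eval 0 := by
      rw [h0, (ho.add_one).neg_pow]; positivity
    have hB : K.eval 1 < 0 := by
      rw [h1, ho.neg_pow]
      have := mul_pos (mul_pos (pow_pos hr m) hc1) hpos
      linarith
    obtain ⟨ξ, hξ, hK⟩ := intermediate_value_Ioo' zero_le_one hcont ⟨hB, hA⟩
    exact ⟨ξ, hξ.1, hξ.2, hK⟩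

/-- If `n` bits with mean `r` have product moments up to order `2m + 1` and are almost surely not
all zero, then `m + 1 ≤ n r`. Otherwise the Krawtchouk polynomial of degree `m + 1` has a root
`ξ < 1`; dividing it by `X - ξ` gives `g` for which `(N - ξ) g(N)²` has mean zero and is
nonnegative on the support, since the number `N` of ones is at least `1` there. -/
theorem HasProductMoments.le_card_mul {Ω ι : Type*} [Fintype Ω] [Fintype ι] {W : Ω → ℝ}
    {y : ι → Ω → ℝ} {m : ℕ} {c r : ℝ} (h : HasProductMoments W y (2 * m + 1) c r)
    (hW : ∀ a, 0 ≤ W a) (hy : ∀ i a, y i a = 0 ∨ y i a = 1) (hc : 0 < c) (hr0 : 0 < r)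
    (hr1 : r < 1) (hcov : ∀ a, W a ≠ 0 → ∃ i, y i a = 1) :
    (m : ℝ) + 1 ≤ Fintype.card ι * r := by
  by_contra! hlt
  rcases Nat.lt_or_ge (2 * m + 1) (Fintype.card ι) with hn | hn
  · obtain ⟨n, hn'⟩ : ∃ n, Fintype.card ι = n + 1 := ⟨Fintype.card ι - 1, by omega⟩
    rw [hn'] at hlt
    push_cast at hlt
    obtain ⟨ξ, -, hξ1, hroot⟩ := exists_root_krawtchouk hr0 (show m ≤ n by omega) hlt
    obtain ⟨g, hg⟩ := Polynomial.dvd_iff_isRoot.2 hroot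
    have hK0 : krawtchouk (n + 1) (m + 1) r ≠ 0 := by
      intro hK
      have h0 := eval_krawtchouk_zero (n + 1) (m + 1) r
      have hch : (0 : ℝ) < (n + 1).choose (m + 1) := by
        exact_mod_cast Nat.choose_pos (by omega)
      rw [hK, Polynomial.eval_zero] at h0
      exact (mul_ne_zero (pow_ne_zero _ (neg_ne_zero.2 hr0.ne')) hch.ne') h0.symm
    have hg0 : g ≠ 0 := by
      rintro rfl
      exact hK0 (by simpa using hg)
    have hdeg : g.natDegree ≤ m := by
      have h1 := natDegree_krawtchouk_le (n + 1) (m + 1) r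
      rw [hg, Polynomial.natDegree_mul (Polynomial.X_sub_C_ne_zero ξ) hg0,
        Polynomial.natDegree_X_sub_C] at h1
      omega
    have hsum := h.sum_esymm_mul_eval_eq_zero hy (m := m + 1) (g := g) (by omega) (by omega)
    have hterm : ∀ a, W a * ((∑ S ∈ Finset.powersetCard (m + 1) Finset.univ,
        ∏ i ∈ S, (y i a - r)) * g.eval (∑ i, y i a)) =
          W a * ((∑ i, y i a) - ξ) * g.eval (∑ i, y i a) ^ 2 := by
      intro a
      rw [esymm_centered_eq_eval_krawtchouk (fun i => hy i a), hn', hg, Polynomial.eval_mul]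
      simp only [Polynomial.eval_sub, Polynomial.eval_X, Polynomial.eval_C]
      ring
    have hN : ∀ a, W a ≠ 0 → ξ < ∑ i, y i a := by
      intro a ha
      obtain ⟨i, hi⟩ := hcov a ha
      refine hξ1.trans_le ?_
      rw [← hi]
      exact Finset.single_le_sum (f := fun i => y i a)
        (fun j _ => by rcases hy j a with hj | hj <;> simp [hj]) (Finset.mem_univ i)
    simp only [hterm] at hsum
    rw [Finset.sum_eq_zero_iff_of_nonneg] at hsum
    · obtain ⟨a, ha, hga⟩ := h.exists_eval_ne_zero hy hc hr0 hr1 hg0 (by omega) (by omega)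
      have := hsum a (Finset.mem_univ a)
      exact mul_ne_zero (mul_ne_zero ha (sub_pos.2 (hN a ha)).ne') (pow_ne_zero 2 hga) this
    · intro a _
      by_cases ha : W a = 0
      · simp [ha]
      · exact mul_nonneg (mul_nonneg (hW a) (sub_pos.2 (hN a ha)).le) (sq_nonneg _)
  · -- With at most `2m + 1` bits the moments force full independence.
    have h1 := h.one_sub Finset.univ (by simpa using hn)
    rw [Finset.sum_eq_zero] at h1
    · exact (mul_pos hc (pow_pos (sub_pos.2 hr1) _)).ne h1
    · intro a _
      by_cases ha : W a = 0
      · simp [ha]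
      · obtain ⟨i, hi⟩ := hcov a ha
        rw [Finset.prod_eq_zero (Finset.mem_univ i) (by simp [hi]), mul_zero]

/-! ### Distributions on bits and their moments -/

/-- The bit `b` as a real number. -/
def bitVal (b : Bool) : ℝ := if b then 1 else 0

@[simp] lemma bitVal_true : bitVal true = 1 := rfl

@[simp] lemma bitVal_false : bitVal false = 0 := rfl

lemma prod_bitVal {ι : Type*} (T : Finset ι) (b : ι → Bool) [Decidable (∀ i ∈ T, b i = true)] :
    ∏ i ∈ T, bitVal (b i) = if ∀ i ∈ T, b i = true then 1 else 0 := by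
  split_ifs with h
  · exact Finset.prod_eq_one fun i hi => by rw [h i hi, bitVal_true]
  · push Not at h
    obtain ⟨i, hi, hb⟩ := h
    exact Finset.prod_eq_zero hi (by simp [Bool.eq_false_iff.2 hb])

lemma hasProductMoments_of_mem_kWiseIndep {n k : ℕ} {p : ℝ} {Q : Measure (Fin n → Bool)}
    (hQ : Q ∈ kWiseIndep n k p) :
    HasProductMoments (fun ω => Q.real {ω}) (fun i ω => bitVal (ω i)) k 1 p := by
  classical
  obtain ⟨hprob, hmarg, hind⟩ := hQ
  intro T hT
  have h1 : ∀ ω : Fin n → Bool, Q.real {ω} * ∏ i ∈ T, bitVal (ω i) =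
      if ∀ i ∈ T, ω i = true then Q.real {ω} else 0 := by
    intro ω
    rw [prod_bitVal]
    split_ifs <;> simp
  have h2 := (hind T hT).measure_inter_preimage_eq_mul Finset.univ
    (sets := fun _ => {true}) fun _ _ => measurableSet_singleton _
  have h3 : (⋂ i ∈ (Finset.univ : Finset T), (fun ω : Fin n → Bool => ω i) ⁻¹' {true}) =
      ((Finset.univ.filter fun ω : Fin n → Bool => ∀ i ∈ T, ω i = true : Finset _) :
        Set (Fin n → Bool)) := by
    ext ω
    simp
  have h4 : ∀ i : Fin n, Q ((fun ω : Fin n → Bool => ω i) ⁻¹' {true}) = ENNReal.ofReal p := by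
    intro i
    rw [← hmarg i, ofReal_measureReal]
    rfl
  simp only [h1]
  rw [← Finset.sum_filter, sum_measureReal_singleton, measureReal_def, ← h3, h2, one_mul]
  simp only [h4, Finset.prod_const, Finset.card_univ, Fintype.card_coe, ENNReal.toReal_pow]
  rcases T.eq_empty_or_nonempty with rfl | ⟨i, -⟩
  · simp
  · rw [ENNReal.toReal_ofReal]
    rw [← hmarg i]
    exact measureReal_nonneg

/-- Bits are independent as soon as the probabilities of all simultaneous successes factor. -/
lemma iIndepFun_of_measure_forall_eq_prod {Ω ι : Type*} [MeasurableSpace Ω] {μ : Measure Ω}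
    {b : ι → Ω → Bool} (hb : ∀ i, Measurable (b i))
    (h : ∀ s : Finset ι, μ {ω | ∀ i ∈ s, b i ω = true} = ∏ i ∈ s, μ {ω | b i ω = true}) :
    iIndepFun b μ := by
  have hset : iIndepSet (fun i => {ω | b i ω = true}) μ := by
    have hmeas : ∀ i, MeasurableSet {ω | b i ω = true} := fun i =>
      hb i (measurableSet_singleton true)
    rw [iIndepSet_iff_meas_biInter hmeas]
    intro s
    rw [← h s]
    congr 1
    ext ω
    simp
  have := (hset.iIndepFun_indicator (β := ℕ)).comp (fun _ m => decide (m = 1))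
    fun _ => measurable_from_top
  convert this using 2 with i
  ext ω
  by_cases hω : b i ω = true <;> simp [hω]

/-- The law of a random vector of bits on a finite weighted space. -/
noncomputable def bitLaw {Ω : Type*} [Fintype Ω] {n : ℕ} (W : Ω → ℝ) (b : Fin n → Ω → Bool) :
    Measure (Fin n → Bool) :=
  ∑ a, ENNReal.ofReal (W a) • Measure.dirac fun i => b i a

open Classical in
lemma bitLaw_apply {Ω : Type*} [Fintype Ω] {n : ℕ} {W : Ω → ℝ} (hW : ∀ a, 0 ≤ W a)
    (b : Fin n → Ω → Bool) (s : Set (Fin n → Bool)) :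
    bitLaw W b s = ENNReal.ofReal (∑ a, W a * if (fun i => b i a) ∈ s then 1 else 0) := by
  rw [bitLaw, Measure.finsetSum_apply, ENNReal.ofReal_sum_of_nonneg]
  · refine Finset.sum_congr rfl fun a _ => ?_
    rw [Measure.smul_apply, Measure.dirac_apply' _ s.to_countable.measurableSet, smul_eq_mul,
      Set.indicator_apply]
    split_ifs <;> simp
  · intro a _
    split_ifs <;> simp [hW a]

/-- It suffices to exhibit a finite weighted space with bits that have the moments of `k`-wise
independent bits and are almost surely not all equal to `1`. -/
lemma mem_zeroLengths_of_hasProductMoments {Ω : Type*} [Fintype Ω] {n k : ℕ} {p : ℝ} {W : Ω → ℝ}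
    {b : Fin n → Ω → Bool} (hk : 1 ≤ k) (hp : 0 ≤ p) (hW : ∀ a, 0 ≤ W a)
    (h : HasProductMoments W (fun i a => bitVal (b i a)) k 1 p)
    (hcov : ∀ a, W a ≠ 0 → ∃ i, b i a = false) : n ∈ zeroLengths k p := by
  classical
  have hT : ∀ T : Finset (Fin n), T.card ≤ k →
      bitLaw W b {ω | ∀ i ∈ T, ω i = true} = ENNReal.ofReal (p ^ T.card) := by
    intro T hT
    rw [bitLaw_apply hW, ← one_mul (p ^ _), ← h T hT]
    simp only [prod_bitVal, Set.mem_ofPred_eq]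
    congr!
  have h1 : ∀ i, bitLaw W b {ω | ω i = true} = ENNReal.ofReal p := by
    intro i
    simpa using hT {i} (by simpa using hk)
  refine ⟨⟨bitLaw W b, ⟨⟨?_⟩, fun i => ?_, fun s hs => ?_⟩, ?_⟩, ?_⟩
  · simpa using hT ∅ (by simp)
  · rw [measureReal_def, h1, ENNReal.toReal_ofReal hp]
  · refine iIndepFun_of_measure_forall_eq_prod (fun i => measurable_pi_apply _) fun t => ?_
    have := hT (t.map (Function.Embedding.subtype _))
      (by rw [Finset.card_map]; exact (Finset.card_le_univ t).trans (by simpa using hs))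
    simp only [h1, Finset.prod_const]
    rw [← ENNReal.ofReal_pow hp, ← Finset.card_map (Function.Embedding.subtype _), ← this]
    simp
  · have : bitLaw W b {ω | ∀ i, ω i = true} = 0 := by
      rw [bitLaw_apply hW, Finset.sum_eq_zero, ENNReal.ofReal_zero]
      intro a _
      by_cases ha : W a = 0
      · rw [ha, zero_mul]
      obtain ⟨i, hi⟩ := hcov a ha
      rw [if_neg, mul_zero]
      intro hall
      have := hall i
      simp [hi] at this
    simp [measureReal_def, this]
  · rintro _ ⟨Q, -, rfl⟩
    exact measureReal_nonneg

lemma exists_hasProductMoments_of_mem_zeroLengths {n k : ℕ} {p : ℝ} (hn : n ∈ zeroLengths k p) :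
    ∃ W : (Fin n → Bool) → ℝ, (∀ ω, 0 ≤ W ω) ∧
      HasProductMoments W (fun i ω => bitVal (ω i)) k 1 p ∧
      ∀ ω, W ω ≠ 0 → ∃ i, ω i = false := by
  obtain ⟨Q, hQ, h0⟩ := hn.1
  have := hQ.1
  refine ⟨fun ω => Q.real {ω}, fun ω => measureReal_nonneg,
    hasProductMoments_of_mem_kWiseIndep hQ, fun ω hω => ?_⟩
  by_contra! hall
  refine hω (le_antisymm ?_ measureReal_nonneg)
  rw [← h0]
  exact measureReal_mono fun ω' hω' i => by
    rw [Set.mem_singleton_iff.1 hω']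
    simpa using hall i

theorem le_of_mem_zeroLengths_odd {n m : ℕ} {p : ℝ} (hp0 : 0 < p) (hp1 : p < 1)
    (hn : n ∈ zeroLengths (2 * m + 1) p) : ((m : ℝ) + 1) / (1 - p) ≤ n := by
  obtain ⟨W, hW, hmom, hcov⟩ := exists_hasProductMoments_of_mem_zeroLengths hn
  rw [div_le_iff₀ (sub_pos.2 hp1)]
  have := hmom.one_sub.le_card_mul hW
    (fun i ω => by cases ω i <;> simp) one_pos (sub_pos.2 hp1) (by linarith)
    (fun ω hω => by
      obtain ⟨i, hi⟩ := hcov ω hω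
      exact ⟨i, by simp [hi]⟩)
  simpa using this

lemma zero_notMem_zeroLengths {k : ℕ} {p : ℝ} : 0 ∉ zeroLengths k p := by
  intro h
  obtain ⟨W, -, hmom, hcov⟩ := exists_hasProductMoments_of_mem_zeroLengths h
  have h1 := hmom ∅ (by simp)
  rw [Finset.sum_eq_zero] at h1
  · simp at h1
  · intro ω _
    rw [show W ω = 0 by by_contra hω; exact (hcov ω hω).elim fun i _ => i.elim0, zero_mul]

/-- For even order, conditioning on the first bit being `1` keeps the all-ones vector impossible
and lowers both the order of independence and the number of bits by one. -/
theorem le_of_mem_zeroLengths_even {n m : ℕ} {p : ℝ} (hp0 : 0 < p) (hp1 : p < 1)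
    (hn : n ∈ zeroLengths (2 * m) p) : (m : ℝ) / (1 - p) + 1 ≤ n := by
  obtain ⟨n, rfl⟩ : ∃ l, n = l + 1 :=
    Nat.exists_eq_succ_of_ne_zero (by rintro rfl; exact zero_notMem_zeroLengths hn)
  push_cast
  rcases m with _ | m
  · simp
  obtain ⟨W, hW, hmom, hcov⟩ := exists_hasProductMoments_of_mem_zeroLengths hn
  have hcond : HasProductMoments (fun ω => W ω * bitVal (ω 0))
      (fun (i : Fin n) ω => bitVal (ω i.succ)) (2 * m + 1) p p := by
    intro T hT
    have hnot : (0 : Fin (n + 1)) ∉ T.map (Fin.succEmb n) := by simp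
    have := hmom (Finset.cons 0 (T.map (Fin.succEmb n)) hnot)
      (by rw [Finset.card_cons, Finset.card_map]; omega)
    simp only [Finset.prod_cons, Finset.prod_map, Finset.card_cons, Finset.card_map] at this
    simp only [mul_assoc]
    rw [← pow_succ', ← one_mul (p ^ _)]
    exact this
  have := hcond.one_sub.le_card_mul
    (fun ω => mul_nonneg (hW ω) (by cases ω 0 <;> simp))
    (fun i ω => by cases ω i.succ <;> simp) hp0 (sub_pos.2 hp1) (by linarith)
    (fun ω hω => by
      obtain ⟨i, hi⟩ := hcov ω (left_ne_zero_of_mul hω)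
      have h0 : ω 0 = true := by
        by_contra h0
        exact right_ne_zero_of_mul hω (by simp [Bool.eq_false_iff.2 h0])
      obtain ⟨j, rfl⟩ := Fin.exists_succ_eq.2 (show i ≠ 0 by rintro rfl; simp [h0] at hi)
      exact ⟨j, by simp [hi]⟩)
  have h2 : ((m : ℝ) + 1) / (1 - p) ≤ n := by
    rw [div_le_iff₀ (sub_pos.2 hp1)]
    simpa using this
  push_cast
  linarith

/-! ### Linear codes without full-weight words -/

section Codes

lemma card_filter_eq_zero_mul_card {K V V' : Type*} [Field K] [AddCommGroup V] [Module K V]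
    [Fintype V]
    [AddCommGroup V'] [Module K V'] [Fintype V'] [DecidableEq V'] {f : V →ₗ[K] V'}
    (hf : Function.Surjective f) :
    (Finset.univ.filter fun v => f v = 0).card * Fintype.card V' = Fintype.card V := by
  have h1 := Submodule.card_eq_card_quotient_mul_card (LinearMap.ker f)
  rw [Nat.card_congr (f.quotKerEquivOfSurjective hf).toEquiv, Nat.card_eq_fintype_card,
    Nat.card_eq_fintype_card (α := V')] at h1
  rw [h1, ← Fintype.card_subtype, ← Nat.card_eq_fintype_card]
  rfl

variable {F : Type*} [Field F] [Fintype F] [DecidableEq F]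

lemma card_filter_forall_dotProduct_ne_zero {n d : ℕ} {u : Fin d → F} (hu : u ≠ 0) :
    ((Finset.univ.filter fun H : Fin n → Fin d → F => ∀ i, H i ⬝ᵥ u ≠ 0).card : ℝ) =
      ((Fintype.card F : ℝ) ^ d) ^ n * (1 - 1 / Fintype.card F) ^ n := by
  obtain ⟨j, hj⟩ := Function.ne_iff.1 hu
  have hq : (Fintype.card F : ℝ) ≠ 0 := by exact_mod_cast Fintype.card_ne_zero
  have hsurj : Function.Surjective (dotProductBilin F F u) := fun c =>
    ⟨Pi.single j ((u j)⁻¹ * c), by simp [dotProductBilin, mul_inv_cancel_left₀ hj]⟩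
  have h1 := card_filter_eq_zero_mul_card hsurj
  have h2 : (Finset.univ.filter fun H : Fin n → Fin d → F => ∀ i, H i ⬝ᵥ u ≠ 0) =
      Fintype.piFinset fun _ =>
        Finset.univ.filter fun h : Fin d → F => ¬ dotProductBilin F F u h = 0 := by
    ext H
    simp only [Finset.mem_filter, Fintype.mem_piFinset, Finset.mem_univ, true_and]
    exact forall_congr' fun i => by simp [dotProductBilin, dotProduct_comm]
  have h3 := Finset.card_filter_add_card_filter_not (s := (Finset.univ : Finset (Fin d → F)))
    (fun h : Fin d → F => dotProductBilin F F u h = 0)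
  rw [h2, Fintype.card_piFinset, Finset.prod_const, Finset.card_univ, Fintype.card_fin]
  push_cast
  rw [← mul_pow]
  congr 1
  rw [Finset.card_univ, Fintype.card_fun, Fintype.card_fin] at h3
  rw [Fintype.card_fun, Fintype.card_fin] at h1
  have h1' : ((Finset.univ.filter fun h : Fin d → F => dotProductBilin F F u h = 0).card : ℝ) *
    Fintype.card F = (Fintype.card F : ℝ) ^ d := by exact_mod_cast h1
  have h3' : ((Finset.univ.filter fun h : Fin d → F => dotProductBilin F F u h = 0).card : ℝ) +
    (Finset.univ.filter fun h : Fin d → F => ¬ dotProductBilin F F u h = 0).card =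
      (Fintype.card F : ℝ) ^ d := by exact_mod_cast h3
  rw [← eq_div_iff hq] at h1'
  rw [mul_sub, mul_one, mul_one_div, ← h1', ← h3']
  ring

lemma card_filter_sum_smul_eq_zero {n d : ℕ} {v : Fin n → F} (hv : v ≠ 0) :
    ((Finset.univ.filter fun H : Fin n → Fin d → F => ∑ i, v i • H i = 0).card : ℝ) =
      ((Fintype.card F : ℝ) ^ d) ^ n / (Fintype.card F : ℝ) ^ d := by
  obtain ⟨j, hj⟩ := Function.ne_iff.1 hv
  have hq : (Fintype.card F : ℝ) ≠ 0 := by exact_mod_cast Fintype.card_ne_zero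
  let f : (Fin n → Fin d → F) →ₗ[F] (Fin d → F) := ∑ i, v i • LinearMap.proj i
  have hf : ∀ H, f H = ∑ i, v i • H i := fun H => by simp [f]
  have hsurj : Function.Surjective f := fun w => by
    refine ⟨Pi.single j ((v j)⁻¹ • w), ?_⟩
    rw [hf, Finset.sum_eq_single j]
    · rw [Pi.single_eq_same, smul_inv_smul₀ hj]
    · intro i _ hi
      rw [Pi.single_eq_of_ne hi, smul_zero]
    · simp
  have h1 := card_filter_eq_zero_mul_card hsurj
  simp only [hf, Fintype.card_fun, Fintype.card_fin] at h1
  rw [eq_div_iff (pow_ne_zero d hq)]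
  exact_mod_cast h1

/-- By a union bound over a uniformly random matrix there is a matrix with rows `H i` such that any
`k` rows are linearly independent and every word `(H i ⬝ᵥ u)ᵢ` has a zero coordinate. The two terms
of `hcount` bound the expected numbers of words without a zero and of short dependencies. -/
lemma exists_rows_of_count_lt_one {n d k : ℕ} (hn : 0 < n)
    (hcount : (Fintype.card F : ℝ) ^ d * (1 - 1 / Fintype.card F) ^ n +
      ((Finset.univ.filter fun v : Fin n → F => hammingNorm v ≤ k).card : ℝ) /
        (Fintype.card F : ℝ) ^ d < 1) :
    ∃ H : Fin n → Fin d → F, (∀ u, ∃ i, H i ⬝ᵥ u = 0) ∧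
      ∀ v : Fin n → F, hammingNorm v ≤ k → ∑ i, v i • H i = 0 → v = 0 := by
  by_contra! hcon
  set q : ℝ := (Fintype.card F : ℝ) with hqdef
  have hq : 0 < q := by rw [hqdef]; exact_mod_cast Fintype.card_pos
  let A : Finset (Fin d → F) := Finset.univ.filter fun u => u ≠ 0
  let B : Finset (Fin n → F) := Finset.univ.filter fun v => hammingNorm v ≤ k ∧ v ≠ 0
  have hcover : (Finset.univ : Finset (Fin n → Fin d → F)) ⊆
      (A.biUnion fun u => Finset.univ.filter fun H : Fin n → Fin d → F => ∀ i, H i ⬝ᵥ u ≠ 0) ∪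
      B.biUnion fun v => Finset.univ.filter fun H : Fin n → Fin d → F => ∑ i, v i • H i = 0 := by
    intro H _
    by_cases hH : ∀ u, ∃ i, H i ⬝ᵥ u = 0
    · obtain ⟨v, hv, hs, h0⟩ := hcon H hH
      exact Finset.mem_union_right _ (Finset.mem_biUnion.2 ⟨v, by simp [B, hv, h0], by simp [hs]⟩)
    · push Not at hH
      obtain ⟨u, hu⟩ := hH
      refine Finset.mem_union_left _ (Finset.mem_biUnion.2 ⟨u, ?_, by simpa using hu⟩)
      simp only [A, Finset.mem_filter, Finset.mem_univ, true_and]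
      rintro rfl
      exact hu ⟨0, hn⟩ (by simp)
  have hle := (Finset.card_le_card hcover).trans ((Finset.card_union_le _ _).trans
    (add_le_add Finset.card_biUnion_le Finset.card_biUnion_le))
  have hle' : (q ^ d) ^ n ≤ ∑ u ∈ A, (q ^ d) ^ n * (1 - 1 / q) ^ n +
      ∑ v ∈ B, (q ^ d) ^ n / q ^ d := by
    simp only [Finset.card_univ, Fintype.card_fun, Fintype.card_fin] at hle
    have hle₁ : (q ^ d) ^ n ≤
        ∑ u ∈ A, ((Finset.univ.filter fun H : Fin n → Fin d → F =>
          ∀ i, H i ⬝ᵥ u ≠ 0).card : ℝ) +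
        ∑ v ∈ B, ((Finset.univ.filter fun H : Fin n → Fin d → F =>
          ∑ i, v i • H i = 0).card : ℝ) := by
      rw [hqdef]
      exact_mod_cast hle
    refine hle₁.trans_eq (congrArg₂ (· + ·) ?_ ?_)
    · exact Finset.sum_congr rfl fun u hu =>
        card_filter_forall_dotProduct_ne_zero (Finset.mem_filter.1 hu).2
    · exact Finset.sum_congr rfl fun v hv =>
        card_filter_sum_smul_eq_zero (Finset.mem_filter.1 hv).2.2
  rw [Finset.sum_const, Finset.sum_const, nsmul_eq_mul, nsmul_eq_mul] at hle'
  have hA : (A.card : ℝ) ≤ q ^ d := by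
    have := Finset.card_le_univ A
    simp only [Fintype.card_fun, Fintype.card_fin] at this
    rw [hqdef]
    exact_mod_cast this
  have hB : (B.card : ℝ) ≤
      ((Finset.univ.filter fun v : Fin n → F => hammingNorm v ≤ k).card : ℝ) := by
    exact_mod_cast Finset.card_le_card fun v hv => by
      simp only [B, Finset.mem_filter, Finset.mem_univ, true_and] at hv ⊢
      exact hv.1
  have hq1 : 0 ≤ 1 - 1 / q := by
    rw [sub_nonneg, div_le_one hq, hqdef]
    exact_mod_cast Fintype.card_pos (α := F)
  have hP : 0 < (q ^ d) ^ n := by positivity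
  have : (q ^ d) ^ n * 1 ≤ (q ^ d) ^ n * (q ^ d * (1 - 1 / q) ^ n +
      ((Finset.univ.filter fun v : Fin n → F => hammingNorm v ≤ k).card : ℝ) / q ^ d) :=
    calc (q ^ d) ^ n * 1 ≤ A.card * ((q ^ d) ^ n * (1 - 1 / q) ^ n) +
          B.card * ((q ^ d) ^ n / q ^ d) := by rw [mul_one]; exact hle'
      _ ≤ q ^ d * ((q ^ d) ^ n * (1 - 1 / q) ^ n) +
          ((Finset.univ.filter fun v : Fin n → F => hammingNorm v ≤ k).card : ℝ) *
            ((q ^ d) ^ n / q ^ d) := by gcongr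
      _ = _ := by ring
  exact absurd (le_of_mul_le_mul_left this hP) (not_le.2 hcount)

lemma linearIndependent_rows_of_hammingNorm {K : Type*} [Field K] [DecidableEq K]
    {n d k : ℕ} {H : Fin n → Fin d → K}
    (hH : ∀ v : Fin n → K, hammingNorm v ≤ k → ∑ i, v i • H i = 0 → v = 0) {T : Finset (Fin n)}
    (hT : T.card ≤ k) : LinearIndependent K fun i : T => H i := by
  rw [Fintype.linearIndependent_iff]
  intro g hg i
  let v : Fin n → K := fun j => if hj : j ∈ T then g ⟨j, hj⟩ else 0
  have hv : v = 0 := by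
    refine hH v ((Finset.card_le_card fun j hj => ?_).trans hT) ?_
    · by_contra hjT
      simp [v, hjT] at hj
    · rw [← hg, ← Finset.sum_subset (Finset.subset_univ T), ← Finset.sum_coe_sort T]
      · exact Finset.sum_congr rfl fun j _ => by simp [v]
      · intro j _ hj
        simp [v, hj]
  have := congrFun hv i
  simpa [v] using this

lemma card_filter_forall_dotProduct_eq_zero {n d : ℕ} {H : Fin n → Fin d → F} {T : Finset (Fin n)}
    (hT : LinearIndependent F fun i : T => H i) :
    (Finset.univ.filter fun u : Fin d → F => ∀ i ∈ T, H i ⬝ᵥ u = 0).card *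
      Fintype.card F ^ T.card = Fintype.card F ^ d := by
  let M : Matrix T (Fin d) F := Matrix.of fun i => H i
  have hrank : M.rank = Fintype.card T := LinearIndependent.rank_matrix hT
  have hsurj : Function.Surjective M.mulVecLin := by
    rw [← LinearMap.range_eq_top]
    refine Submodule.eq_top_of_finrank_eq ?_
    rw [Module.finrank_fintype_fun_eq_card, ← hrank]
    rfl
  have h1 := card_filter_eq_zero_mul_card hsurj
  simp only [Fintype.card_fun, Fintype.card_fin, Fintype.card_coe] at h1
  rw [← h1]
  congr 3
  ext u
  simp only [funext_iff, Matrix.mulVecLin_apply, Matrix.mulVec, M, Matrix.of_apply, Pi.zero_apply,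
    Subtype.forall]

/-- The indicators of the nonzero coordinates of a uniformly random word of the code are `k`-wise
independent when any `k` rows are linearly independent. -/
lemma mem_zeroLengths_of_rows {n d k : ℕ} (hk : 1 ≤ k) {H : Fin n → Fin d → F}
    (hzero : ∀ u, ∃ i, H i ⬝ᵥ u = 0)
    (hH : ∀ v : Fin n → F, hammingNorm v ≤ k → ∑ i, v i • H i = 0 → v = 0) :
    n ∈ zeroLengths k (1 - 1 / (Fintype.card F : ℝ)) := by
  have hq : (0 : ℝ) < Fintype.card F := by exact_mod_cast Fintype.card_pos
  have hq1 : 0 ≤ 1 - 1 / (Fintype.card F : ℝ) := by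
    rw [sub_nonneg, div_le_one hq]
    exact_mod_cast Fintype.card_pos (α := F)
  have hmom : HasProductMoments (fun _ : Fin d → F => 1 / (Fintype.card F : ℝ) ^ d)
      (fun (i : Fin n) u => bitVal (decide (H i ⬝ᵥ u = 0))) k 1 (1 / (Fintype.card F : ℝ)) := by
    intro T hT
    have h1 := card_filter_forall_dotProduct_eq_zero (linearIndependent_rows_of_hammingNorm hH hT)
    have h1' : ((Finset.univ.filter fun u : Fin d → F => ∀ i ∈ T, H i ⬝ᵥ u = 0).card : ℝ) *
      (Fintype.card F : ℝ) ^ T.card = (Fintype.card F : ℝ) ^ d := by exact_mod_cast h1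
    simp only [prod_bitVal, decide_eq_true_eq]
    rw [← Finset.mul_sum, Finset.sum_boole, ← h1', one_div_pow]
    have hcard : ((Finset.univ.filter fun u : Fin d → F => ∀ i ∈ T, H i ⬝ᵥ u = 0).card : ℝ) ≠ 0 :=
      left_ne_zero_of_mul (h1'.trans_ne (pow_ne_zero _ hq.ne'))
    field_simp
  have hmom' : HasProductMoments (fun _ : Fin d → F => 1 / (Fintype.card F : ℝ) ^ d)
      (fun (i : Fin n) u => bitVal (decide (H i ⬝ᵥ u ≠ 0))) k 1
        (1 - 1 / (Fintype.card F : ℝ)) := by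
    convert hmom.one_sub using 3 with i u
    by_cases h : H i ⬝ᵥ u = 0 <;> simp [h]
  refine mem_zeroLengths_of_hasProductMoments hk hq1 (fun _ => by positivity) hmom' fun u _ => ?_
  obtain ⟨i, hi⟩ := hzero u
  exact ⟨i, by simp [hi]⟩

/-- Chernoff-type bound for the volume of a Hamming ball, from the weight enumerator at `x`. -/
lemma card_hammingNorm_le_mul_pow_le {n k : ℕ} {x : ℝ} (hx0 : 0 ≤ x) (hx1 : x ≤ 1) :
    ((Finset.univ.filter fun v : Fin n → F => hammingNorm v ≤ k).card : ℝ) * x ^ k ≤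
      (1 + Fintype.card F * x) ^ n := by
  have hprod : ∀ v : Fin n → F, ∏ i, (if v i = 0 then 1 else x) = x ^ hammingNorm v := by
    intro v
    simp only [← ite_not (_ = (0 : F)) x]
    rw [← Finset.prod_filter, Finset.prod_const]
    rfl
  calc _ = ∑ v ∈ Finset.univ.filter fun v : Fin n → F => hammingNorm v ≤ k, x ^ k := by
        rw [Finset.sum_const, nsmul_eq_mul]
    _ ≤ ∑ v ∈ Finset.univ.filter fun v : Fin n → F => hammingNorm v ≤ k, x ^ hammingNorm v :=
        Finset.sum_le_sum fun v hv =>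
          pow_le_pow_of_le_one hx0 hx1 (Finset.mem_filter.1 hv).2
    _ ≤ ∑ v : Fin n → F, x ^ hammingNorm v :=
        Finset.sum_le_sum_of_subset_of_nonneg (Finset.filter_subset _ _)
          fun v _ _ => pow_nonneg hx0 _
    _ = (∑ c : F, if c = 0 then 1 else x) ^ n := by
        rw [Fintype.sum_pow]
        simp only [hprod]
    _ ≤ (1 + Fintype.card F * x) ^ n := by
        refine pow_le_pow_left₀ (Finset.sum_nonneg fun c _ => by split_ifs <;> positivity) ?_ n
        calc ∑ c : F, (if c = 0 then 1 else x) ≤ ∑ c : F, ((if c = 0 then 1 else 0) + x) :=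
              Finset.sum_le_sum fun c _ => by split_ifs <;> linarith
          _ = 1 + Fintype.card F * x := by
              rw [Finset.sum_add_distrib, Finset.sum_ite_eq' Finset.univ (0 : F)]
              simp

end Codes

/-! ### Choice of the code length -/

/-- With `d = 11 k` and `n = ⌈q (d log q + 1)⌉` the two error terms of the union bound over random
matrices are at most `1 / e` and `1 / 4`. -/
lemma exists_mem_zeroLengths_card (F : Type*) [Field F] [Fintype F] {k : ℕ} (hk : 1 ≤ k) :
    ∃ n ∈ zeroLengths k (1 - 1 / (Fintype.card F : ℝ)),
      (n : ℝ) ≤ 14 * (k * Fintype.card F) * Real.log (Fintype.card F) := by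
  classical
  obtain ⟨q, hq⟩ : ∃ q : ℝ, q = Fintype.card F := ⟨_, rfl⟩
  have hq2 : 2 ≤ q := by
    rw [hq]
    exact_mod_cast Fintype.one_lt_card (α := F)
  have hq0 : 0 < q := by linarith
  have hk1 : (1 : ℝ) ≤ k := by exact_mod_cast hk
  rw [← hq]
  set L := Real.log q with hL
  have hL1 : 0.69 ≤ L :=
    (by linarith [Real.log_two_gt_d9] : 0.69 ≤ Real.log 2).trans
      (Real.log_le_log two_pos hq2)
  have hLq : L ≤ q := by linarith [Real.log_le_sub_one_of_pos hq0]
  set n := ⌈q * ((11 * k : ℕ) * L + 1)⌉₊ with hn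
  have hnlo : q * ((11 * k : ℕ) * L + 1) ≤ n := Nat.le_ceil _
  have hnpos : (0 : ℝ) < n := lt_of_lt_of_le (by positivity) hnlo
  have hkL : 0.69 ≤ k * L := by nlinarith
  have hnhi : (n : ℝ) ≤ 14 * (k * q) * L := by
    have h1 : (n : ℝ) < q * ((11 * k : ℕ) * L + 1) + 1 := Nat.ceil_lt_add_one (by positivity)
    push_cast at h1
    nlinarith
  have hkn : (k : ℝ) ≤ n := by
    push_cast at hnlo
    nlinarith
  have hfull : q ^ (11 * k) * (1 - 1 / q) ^ n ≤ 1 / 2 := by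
    have h1 : 1 - 1 / q ≤ Real.exp (-(1 / q)) := by
      linarith [Real.add_one_le_exp (-(1 / q))]
    have h2 : 0 ≤ 1 - 1 / q := by
      rw [sub_nonneg, div_le_one hq0]; linarith
    have h3 : q ^ (11 * k) = Real.exp ((11 * k : ℕ) * L) := by
      rw [Real.exp_nat_mul, Real.exp_log hq0]
    calc q ^ (11 * k) * (1 - 1 / q) ^ n
        ≤ Real.exp ((11 * k : ℕ) * L) * Real.exp (-(1 / q)) ^ n := by
          rw [h3]
          exact mul_le_mul_of_nonneg_left (pow_le_pow_left₀ h2 h1 n) (Real.exp_pos _).le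
      _ = Real.exp ((11 * k : ℕ) * L - n / q) := by
          rw [← Real.exp_nat_mul, ← Real.exp_add]
          congr 1
          ring
      _ ≤ Real.exp (-1) := by
          rw [Real.exp_le_exp]
          have : (11 * k : ℕ) * L + 1 ≤ n / q := by
            rw [le_div_iff₀ hq0]; linarith
          linarith
      _ ≤ 1 / 2 := by
          rw [Real.exp_neg, ← one_div]
          exact one_div_le_one_div_of_le two_pos (by linarith [Real.exp_one_gt_d9])
  have hball : ((Finset.univ.filter fun v : Fin n → F => hammingNorm v ≤ k).card : ℝ) /
      q ^ (11 * k) ≤ 1 / 4 := by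
    -- The weight enumerator is evaluated at `x = k / (q n)`, which balances the two factors.
    have hx1 : (k : ℝ) / (q * n) ≤ 1 := by
      rw [div_le_one (by positivity)]
      nlinarith
    have h1 := card_hammingNorm_le_mul_pow_le (F := F) (n := n) (k := k)
      (x := k / (q * n)) (by positivity) hx1
    have h2 : (1 + (Fintype.card F : ℝ) * (k / (q * n))) ^ n ≤ Real.exp 1 ^ k := by
      have h3 : (1 + (Fintype.card F : ℝ) * (k / (q * n))) ≤ Real.exp (k / n) := by
        rw [← hq, show q * (k / (q * n)) = k / n by field_simp, add_comm]
        exact Real.add_one_le_exp _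
      calc _ ≤ Real.exp (k / n) ^ n := pow_le_pow_left₀ (by positivity) h3 n
        _ = Real.exp 1 ^ k := by
          rw [← Real.exp_nat_mul, ← Real.exp_nat_mul]
          congr 1
          field_simp
    have h4 := h1.trans h2
    rw [← le_div_iff₀ (by positivity), ← div_pow] at h4
    have h5 : Real.exp 1 / (k / (q * n)) / q ^ 11 ≤ 1 / 4 := by
      rw [div_div_eq_mul_div, div_div, div_le_iff₀ (by positivity)]
      have h6 : (n : ℝ) ≤ 14 * (k * q) * q := hnhi.trans (by gcongr)
      have h7 : (2 : ℝ) ^ 8 ≤ q ^ 8 := pow_le_pow_left₀ two_pos.le hq2 8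
      calc Real.exp 1 * (q * n) ≤ 3 * (q * (14 * (k * q) * q)) := by
            gcongr
            linarith [Real.exp_one_lt_d9]
        _ = 42 * (k * q ^ 3) := by ring
        _ ≤ (q ^ 8 / 4) * (k * q ^ 3) := by
            gcongr
            linarith
        _ = 1 / 4 * (k * q ^ 11) := by ring
    calc _ ≤ (Real.exp 1 / (k / (q * n))) ^ k / q ^ (11 * k) := by gcongr
      _ = (Real.exp 1 / (k / (q * n)) / q ^ 11) ^ k := by rw [pow_mul, ← div_pow]
      _ ≤ (1 / 4) ^ k := pow_le_pow_left₀ (by positivity) h5 k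
      _ ≤ 1 / 4 := pow_le_of_le_one (by norm_num) (by norm_num) (by omega)
  obtain ⟨H, hzero, hH⟩ := exists_rows_of_count_lt_one (F := F) (n := n) (d := 11 * k) (k := k)
    (by exact_mod_cast hnpos) (by rw [← hq]; linarith)
  refine ⟨n, ?_, hnhi⟩
  rw [hq]
  exact mem_zeroLengths_of_rows hk hzero hH

lemma exists_mem_zeroLengths_of_isPrimePow {k q : ℕ} (hk : 1 ≤ k) (hq : IsPrimePow q) :
    ∃ n ∈ zeroLengths k (1 - 1 / (q : ℝ)), (n : ℝ) ≤ 14 * (k * q) * Real.log q := by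
  obtain ⟨p, m, hp, hm, rfl⟩ := hq
  have : Fact p.Prime := ⟨hp.nat_prime⟩
  have := Fintype.ofFinite (GaloisField p m)
  have h := exists_mem_zeroLengths_card (GaloisField p m) hk
  rwa [← Nat.card_eq_fintype_card, GaloisField.card p m hm.ne'] at h

/-! ### Existence for every marginal -/

lemma sum_bernoulli_mul_prod_bitVal {n : ℕ} (s : ℝ) (T : Finset (Fin n)) :
    ∑ β : Fin n → Bool, (∏ i, if β i then s else 1 - s) * ∏ i ∈ T, bitVal (β i) = s ^ T.card := by
  have h1 : ∀ β : Fin n → Bool, (∏ i, if β i then s else 1 - s) * ∏ i ∈ T, bitVal (β i) =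
      ∏ i, (if β i then s else 1 - s) * if i ∈ T then bitVal (β i) else 1 := by
    intro β
    rw [Finset.prod_mul_distrib, Finset.prod_ite_mem, Finset.univ_inter]
  simp only [h1]
  rw [← Fintype.prod_sum
    fun (i : Fin n) (c : Bool) => (if c then s else 1 - s) * if i ∈ T then bitVal c else 1,
    ← Finset.prod_const, ← Finset.univ_inter T, ← Finset.prod_ite_mem]
  refine Finset.prod_congr rfl fun i _ => ?_
  by_cases hi : i ∈ T <;> simp [hi]

/-- Multiplying each bit by an independent Bernoulli bit lowers the marginal and keeps both the
independence and the impossibility of the all-ones vector. -/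
lemma mem_zeroLengths_of_le {n k : ℕ} {p p' : ℝ} (hk : 1 ≤ k) (hp : 0 ≤ p) (hp' : 0 < p')
    (hle : p ≤ p') (hn : n ∈ zeroLengths k p') : n ∈ zeroLengths k p := by
  obtain ⟨W, hW, hmom, hcov⟩ := exists_hasProductMoments_of_mem_zeroLengths hn
  have hs0 : 0 ≤ p / p' := by positivity
  have hs1 : 0 ≤ 1 - p / p' := by rw [sub_nonneg, div_le_one hp']; exact hle
  refine mem_zeroLengths_of_hasProductMoments hk hp
    (W := fun a : (Fin n → Bool) × (Fin n → Bool) =>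
      W a.1 * ∏ i, if a.2 i then p / p' else 1 - p / p')
    (b := fun i a => a.1 i && a.2 i)
    (fun a => mul_nonneg (hW _) (Finset.prod_nonneg fun i _ => by split_ifs <;> assumption))
    (fun T hT => ?_) fun a ha => ?_
  · have hand : ∀ b b' : Bool, bitVal (b && b') = bitVal b * bitVal b' := by
      intro b b'
      cases b <;> cases b' <;> simp
    simp only [hand, Finset.prod_mul_distrib]
    rw [Fintype.sum_prod_type]
    simp only [mul_mul_mul_comm (W _), ← Finset.mul_sum, sum_bernoulli_mul_prod_bitVal]
    rw [← Finset.sum_mul, hmom T hT, one_mul, one_mul,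
      ← mul_pow, mul_div_cancel₀ _ hp'.ne']
  · obtain ⟨i, hi⟩ := hcov a.1 (left_ne_zero_of_mul ha)
    exact ⟨i, by simp [hi]⟩

lemma zeroLengths_anti {k l : ℕ} {p : ℝ} (hkl : k ≤ l) : zeroLengths l p ⊆ zeroLengths k p := by
  rintro n ⟨⟨Q, hQ, h0⟩, -⟩
  refine ⟨⟨Q, ⟨hQ.1, hQ.2.1, fun s hs => hQ.2.2 s (hs.trans hkl)⟩, h0⟩, ?_⟩
  rintro _ ⟨Q', -, rfl⟩
  exact measureReal_nonneg

lemma zeroLengths_nonempty (k : ℕ) {p : ℝ} (hp0 : 0 ≤ p) (hp1 : p < 1) :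
    (zeroLengths k p).Nonempty := by
  obtain ⟨m, hm⟩ := pow_unbounded_of_one_lt (1 / (1 - p)) (one_lt_two (α := ℝ))
  have hq : IsPrimePow (2 ^ (m + 1)) := Nat.prime_two.isPrimePow.pow m.succ_ne_zero
  obtain ⟨n, hn, -⟩ := exists_mem_zeroLengths_of_isPrimePow (le_max_right k 1) hq
  have h2 : (1 : ℝ) ≤ 2 ^ m := one_le_pow₀ one_le_two
  push_cast at hn
  refine ⟨n, zeroLengths_anti (le_max_left k 1)
    (mem_zeroLengths_of_le (le_max_right k 1) hp0 ?_ ?_ hn)⟩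
  · rw [sub_pos, div_lt_one (by positivity), pow_succ]
    linarith
  · have h3 : 1 / (2 : ℝ) ^ (m + 1) ≤ 1 - p := by
      rw [one_div_le (by positivity) (sub_pos.2 hp1), pow_succ]
      linarith
    linarith

theorem mainTheorem3 :
    (∀ (k : ℕ) (p : ℝ), 1 / 2 ≤ p → p < 1 →
      (zeroLengths k p).Nonempty ∧
      (Even k → (k : ℝ) / (2 * (1 - p)) + 1 ≤ (criticalLength k p : ℝ)) ∧
      (Odd k → ((k : ℝ) + 1) / (2 * (1 - p)) ≤ (criticalLength k p : ℝ))) ∧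
    (∃ C : ℝ, 0 < C ∧ ∀ (k q : ℕ) (p : ℝ), 1 ≤ k → IsPrimePow q → 1 - p = 1 / (q : ℝ) →
      (criticalLength k p : ℝ) ≤ C * ((k : ℝ) / (1 - p)) * Real.log (1 / (1 - p))) := by
  refine ⟨fun k p hp hp1 => ?_, 14, by norm_num, fun k q p hk hq hpq => ?_⟩
  · have hp0 : 0 < p := by linarith
    have hne := zeroLengths_nonempty k hp0.le hp1
    have hmem : criticalLength k p ∈ zeroLengths k p := Nat.sInf_mem hne
    refine ⟨hne, fun he => ?_, fun ho => ?_⟩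
    · obtain ⟨m, rfl⟩ := he.two_dvd
      convert le_of_mem_zeroLengths_even hp0 hp1 hmem using 2
      push_cast
      exact mul_div_mul_left _ _ two_ne_zero
    · obtain ⟨m, rfl⟩ := ho
      convert le_of_mem_zeroLengths_odd hp0 hp1 hmem using 1
      push_cast
      rw [show (2 * (m : ℝ) + 1 + 1) = 2 * (m + 1) by ring]
      exact mul_div_mul_left _ _ two_ne_zero
  · obtain ⟨n, hn, hle⟩ := exists_mem_zeroLengths_of_isPrimePow hk hq
    obtain rfl : p = 1 - 1 / (q : ℝ) := by linarith
    rw [hpq, one_div_one_div, div_div_eq_mul_div, div_one]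
    refine le_trans ?_ hle
    exact_mod_cast Nat.sInf_le hn
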